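/- **Setting.** Let $N\ge 1$ agents share $T\ge 1$ resources. For each $n\in[N]$ let $E_n>0$ and $\underline x_n,\overline x_n\in\mathbb R^T$ be such that $$\mathcal X_n=\Big\{v\in\mathbb R^T:\ \sum_t v_t=E_n,\ \underline x_{n,t}\le v_t\le\overline x_{n,t}\ \forall t\Big\}\neq\emptyset ,$$ and put $\mathcal X=\prod_n\mathcal X_n\subset\mathbb R^{N\times T}$, $\mathcal Y_p=\{y\in\mathbb R^{N\times T}:\sum_n y_n=p\}$. Let $f:\mathbb R^T\to\mathbb R$, and let $\mathcal P\subset\mathbb R^T$ be a set all of whose elements $p$ satisfy $\sum_t p_t=\sum_n E_n$ and $\sum_n\underline x_{n,t}\le p_t\le\sum_n\overline x_{n,t}$ for all $t$. The global problem is to minimize $f$ over $\mathcal P^{D}=\{p\in\mathcal P:\mathcal X\cap\mathcal Y_p\ne\emptyset\}$; it is infeasible if $\mathcal P^{D}=\emptyset$, and $f^*=\inf_{\mathcal P^D} f$ is its optimal value. **Norms.** Let $\|\cdot\|$ be the norm on $\mathbb R^{N\times T}$ used in the tests of the algorithm, with $\|z\|_2\le\|z\|$ for all $z$. Let $\|\cdot\|'$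 be a norm (or seminorm) on $\mathbb R^T$ and $\kappa$ a constant with $\|\sum_n z_n\|'\le\kappa\|z\|$ for all $z\in\mathbb R^{N\times T}$ (for instance $\kappa=1$ for the $\ell^1$ norms, $\kappa=\sqrt N$ for the Euclidean norms). **NI-APM.** The input is $p\in\mathbb R^T$, a start $y^{(0)}\in\mathbb R^{N\times T}$, a threshold constant $B$ and tolerances $\varepsilon_{\rm cvg},\varepsilon_{\rm dis}>0$. For $k\ge1$ the iterates are $x_n^{(k)}=P_{\mathcal X_n}(y_n^{(k-1)})$ (Euclidean projection), $\nu^{(k)}=\frac1N(p-\sum_n x^{(k)}_n)$ and $y^{(k)}_n=x^{(k)}_n+\nu^{(k)}$. Set $\varepsilon=\varepsilon_{\rm cvg}$ and iterate until the first $k\ge2$ with $\|x^{(k)}-x^{(k-1)}\|<\varepsilon$. If then $\|x^{(k)}-y^{(k)}\|\le\varepsilon_{\rm dis}$, return TRUE and the profiles $x^{(k)}$. Otherwise let $\mathcal T=\{t: B\varepsilon<\nu^{(k)}_t\}$ and $A_{\mathcal T}=\sum_{t\in\mathcal T}\sum_n x^{(k)}_{n,t}$. If $A_{\mathcal T}-\sum_{t\in\mathcal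 T}p_t<0$, return FALSE and $(\mathcal T,A_{\mathcal T})$. Otherwise replace $\varepsilon$ by $\varepsilon/2$, continue the iterations until the next $k$ with $\|x^{(k)}-x^{(k-1)}\|<\varepsilon$, and repeat these tests. **Non-intrusive optimal disaggregation.** Start with $s=0$, $\mathcal P^{(0)}=\mathcal P$. At iteration $s$: if $\mathcal P^{(s)}=\emptyset$, exit (infeasible). Otherwise take a minimizer $p^{(s)}$ of $f$ over $\mathcal P^{(s)}$ and call NI-APM on $p^{(s)}$ from an arbitrary start. If it returns TRUE, stop with $p^{(s)}$ and the returned profiles. If it returns $(\mathcal T,A_{\mathcal T})$, set $\mathcal P^{(s+1)}=\mathcal P^{(s)}\cap\{q:\sum_{t\in\mathcal T}q_t\le A_{\mathcal T}\}$ and go to iteration $s+1$. **Assumptions.** A minimizer exists (and is found) for every nonempty $\mathcal P^{(s)}$ that is reached. For every $p=p^{(s)}$ on which NI-APM is called, with its start $y^{(0)}$, there is $\rho\in(0,1)$ with $$\|x^{(k+1)}-x^{(k)}\|_2\le\rho\|x^{(k)}-x^{(k-1)}\|_2\quad\text{and}\quad\|y^{(k+1)}-y^{(k)}\|_2\le\rho\|y^{(k)}-y^{(k-1)}\|_2\qquad(k\ge2)$$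 and $B>\frac1{1-\rho}$; and $2B\,\varepsilon_{\rm cvg}<|\nu^\infty_t|$ for every $t$ with $\nu^\infty_t\ne0$, where $\nu^\infty=\lim_k\nu^{(k)}$. **Claim.** (i) If the global problem is infeasible, the algorithm stops at some iteration $s\le2^T-2$: it either exits because $\mathcal P^{(s)}=\emptyset$, or stops with $p^{(s)}\in\mathcal P$ and $x^*\in\mathcal X$ such that $\|\sum_n x^*_n-p^{(s)}\|'\le\kappa\,\varepsilon_{\rm dis}$. If moreover $\varepsilon_{\rm dis}<\|x-y\|$ for all $x\in\mathcal X$ and $y\in\mathcal Y_{p^{(s)}}$, for every $p^{(s)}$ on which NI-APM is called, then the algorithm exits because $\mathcal P^{(s)}=\emptyset$, at some iteration $s\le2^T-2$. (ii) If the global problem is feasible, the algorithm stops at some iteration $s\le 2^T-2$ with an allocation $p^{(s)}$ and profiles $x^*$ such that $$p^{(s)}\in\mathcal P,\qquad x^*_n\in\mathcal X_n\ \ \forall n,\qquad \Big\|\sum_n x^*_n-p^{(s)}\Big\|'\le\kappa\,\varepsilon_{\rm dis},\qquad f(p^{(s)})\le f^*,$$ and in particular $f^*>-\infty$. -/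

import Mathlib

open Filter Topology

namespace Disagg

/-- An aggregate allocation, an element of `ℝ^T` with its Euclidean norm. -/
abbrev Alloc (T : ℕ) := EuclideanSpace ℝ (Fin T)

/-- A family of `N` individual profiles, an element of `ℝ^{N × T}`. The default norm on this type
is the Euclidean (Frobenius) norm of `ℝ^{NT}`. -/
abbrev Profile (N T : ℕ) := PiLp 2 (fun _ : Fin N => Alloc T)

/-- The private data of the `N` agents: demands `E n` and bounds `lo n t`, `hi n t`, such that each
individual feasibility set is nonempty. -/
structure Agents (N T : ℕ) where
  E : Fin N → ℝ
  lo : Fin N → Fin T → ℝ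
  hi : Fin N → Fin T → ℝ
  E_pos : ∀ n, 0 < E n
  nonempty : ∀ n, ∃ v : Alloc T, ∑ t, v t = E n ∧ ∀ t, lo n t ≤ v t ∧ v t ≤ hi n t

section Projection

variable {V : Type*} [NormedAddCommGroup V] [InnerProductSpace ℝ V]

/-- The Euclidean projection onto `C`: the point of `C` closest to `v`. -/
noncomputable def proj (C : Set V) (v : V) : V :=
  Classical.epsilon fun w => w ∈ C ∧ ∀ z ∈ C, ‖v - w‖ ≤ ‖v - z‖

theorem proj_spec {C : Set V} (hne : C.Nonempty) (hC : IsComplete C) (hconv : Convex ℝ C) (v : V) :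
    proj C v ∈ C ∧ ∀ z ∈ C, ‖v - proj C v‖ ≤ ‖v - z‖ := by
  refine Classical.epsilon_spec
    (p := fun w => w ∈ C ∧ ∀ z ∈ C, ‖v - w‖ ≤ ‖v - z‖) ?_
  obtain ⟨w, hw, h⟩ := exists_norm_eq_iInf_of_complete_convex hne hC hconv v
  refine ⟨w, hw, fun z hz => ?_⟩
  rw [h]
  exact ciInf_le ⟨0, by rintro _ ⟨x, rfl⟩; exact norm_nonneg _⟩ (⟨z, hz⟩ : C)

end Projection

section Problem

variable {N T : ℕ} (A : Agents N T)

/-- The individual feasibility set of agent `n`. -/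
def Agents.indiv (n : Fin N) : Set (Alloc T) :=
  {v | ∑ t, v t = A.E n ∧ ∀ t, A.lo n t ≤ v t ∧ v t ≤ A.hi n t}

/-- The product of the individual feasibility sets. -/
def Agents.feasible : Set (Profile N T) := {x | ∀ n, x n ∈ A.indiv n}

/-- The profiles aggregating to `p`. -/
def aggregating (N : ℕ) (p : Alloc T) : Set (Profile N T) := {y | ∀ t, ∑ n, y n t = p t}

/-- The aggregate conditions, necessary for `p` to be disaggregable. -/
def Agents.aggCond (p : Alloc T) : Prop :=
  ∑ t, p t = ∑ n, A.E n ∧ ∀ t, ∑ n, A.lo n t ≤ p t ∧ p t ≤ ∑ n, A.hi n t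

/-- The feasible allocations of the global problem: those in `P` that are disaggregable. -/
def Agents.disaggregable (P : Set (Alloc T)) : Set (Alloc T) :=
  {p | p ∈ P ∧ ∃ x ∈ A.feasible, p = ∑ n, x n}

/-- The step in which each agent projects her own profile onto her feasibility set. -/
noncomputable def Agents.projIndiv (y : Profile N T) : Profile N T :=
  WithLp.toLp 2 fun n => proj (A.indiv n) (y n)

/-- The vector `ν = (p - ∑ₙ xₙ) / N` sent by the operator to the agents. -/
noncomputable def nu (p : Alloc T) (x : Profile N T) : Alloc T :=
  (1 / (N : ℝ)) • (p - ∑ n, x n)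

/-- The step `yₙ = xₙ + ν`, which is the Euclidean projection of `x` onto `aggregating N p`. -/
noncomputable def aggStep (p : Alloc T) (x : Profile N T) : Profile N T :=
  WithLp.toLp 2 fun n => x n + nu p x

/-- The iterates `y⁽ᵏ⁾`, `k ≥ 0`, of alternate projections started at `y0`. -/
noncomputable def Agents.iterY (p : Alloc T) (y0 : Profile N T) (k : ℕ) : Profile N T :=
  (fun y => aggStep p (A.projIndiv y))^[k] y0

/-- The iterates `x⁽ᵏ⁾ = P_X(y⁽ᵏ⁻¹⁾)`, `k ≥ 1` (the value at `k = 0` is never used). -/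
noncomputable def Agents.iterX (p : Alloc T) (y0 : Profile N T) (k : ℕ) : Profile N T :=
  A.projIndiv (A.iterY p y0 (k - 1))

/-- `ν⁽ᵏ⁾`, for `k ≥ 1`. -/
noncomputable def Agents.iterNu (p : Alloc T) (y0 : Profile N T) (k : ℕ) : Alloc T :=
  nu p (A.iterX p y0 k)

/-- `ρ ∈ (0, 1)` is a geometric rate for the alternate projections started at `y0`. Since the first
iterates are `x⁽¹⁾, y⁽¹⁾`, the inequalities start at `k = 2`. -/
def Agents.IsRate (p : Alloc T) (y0 : Profile N T) (ρ : ℝ) : Prop :=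
  0 < ρ ∧ ρ < 1 ∧ ∀ k, 2 ≤ k →
    ‖A.iterX p y0 (k + 1) - A.iterX p y0 k‖ ≤ ρ * ‖A.iterX p y0 k - A.iterX p y0 (k - 1)‖ ∧
    ‖A.iterY p y0 (k + 1) - A.iterY p y0 k‖ ≤ ρ * ‖A.iterY p y0 k - A.iterY p y0 (k - 1)‖

/-- The conditions on the threshold constant `B` and the tolerance `ε` for the allocation `p`:
`B > 1 / (1 - ρ)` and `2 B ε` is less than every nonzero `|ν_t^∞|`, where `ν^∞ = lim ν⁽ᵏ⁾`. -/
def Agents.ParamsOK (p : Alloc T) (y0 : Profile N T) (B ε : ℝ) : Prop :=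
  (∃ ρ, A.IsRate p y0 ρ ∧ 1 / (1 - ρ) < B) ∧
  ∀ νinf : Alloc T, Tendsto (A.iterNu p y0) atTop (𝓝 νinf) →
    ∀ t, νinf t ≠ 0 → ε * (2 * B) < |νinf t|

end Problem

section Algorithm

/-- The parameters shared by all calls of NI-APM: the threshold constant `B`, the initial
convergence tolerance `εcvg`, the disaggregation tolerance `εdis` and the norm on `ℝ^{NT}` used in
the tests. -/
structure Params (N T : ℕ) where
  B : ℝ
  εcvg : ℝ
  εdis : ℝ
  nrm : Seminorm ℝ (Profile N T)

variable {N T : ℕ} (A : Agents N T) (c : Params N T)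

/-- The set of resources computed from `ν⁽ᵏ⁾` at the current tolerance `ε`. -/
noncomputable def cutSet (p : Alloc T) (y0 : Profile N T) (ε : ℝ) (k : ℕ) : Finset (Fin T) :=
  {t | c.B * ε < A.iterNu p y0 k t}

/-- The right-hand side of the cut computed from `x⁽ᵏ⁾` at the current tolerance `ε`. -/
noncomputable def cutRhs (p : Alloc T) (y0 : Profile N T) (ε : ℝ) (k : ℕ) : ℝ :=
  ∑ t ∈ cutSet A c p y0 ε k, ∑ n, A.iterX p y0 k n t

/-- The disaggregation test at iterate `k`. -/
def accepts (p : Alloc T) (y0 : Profile N T) (k : ℕ) : Prop :=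
  c.nrm (A.iterX p y0 k - A.iterY p y0 k) ≤ c.εdis

/-- The test that the computed cut is violated by `p`. -/
def cutViolated (p : Alloc T) (y0 : Profile N T) (ε : ℝ) (k : ℕ) : Prop :=
  cutRhs A c p y0 ε k - ∑ t ∈ cutSet A c p y0 ε k, p t < 0

/-- The repeat loop, entered with tolerance `ε` after `x⁽¹⁾, …, x⁽ᵏ⁾` have been computed, is left at
iterate `K`. -/
def LoopStops (p : Alloc T) (y0 : Profile N T) (ε : ℝ) (k K : ℕ) : Prop :=
  IsLeast {K' | k < K' ∧ c.nrm (A.iterX p y0 K' - A.iterX p y0 (K' - 1)) < ε} K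

/-- In the execution of NI-APM on `p` from `y0`, the repeat loop is at some moment left at
iterate `K` with tolerance `ε`. If neither test succeeds there, the tolerance is halved and the
iterations of alternate projections continue. -/
inductive StopsAt (p : Alloc T) (y0 : Profile N T) : ℝ → ℕ → Prop
  | first {K : ℕ} : LoopStops A c p y0 c.εcvg 1 K → StopsAt p y0 c.εcvg K
  | retry {ε : ℝ} {K K' : ℕ} : StopsAt p y0 ε K → ¬ accepts A c p y0 K →
      ¬ cutViolated A c p y0 ε K → LoopStops A c p y0 (ε / 2) K K' → StopsAt p y0 (ε / 2) K'

/-- NI-APM terminates with `DISAG = TRUE` and the agents adopt the profiles `x`. -/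
def NIAPMTrue (p : Alloc T) (y0 x : Profile N T) : Prop :=
  ∃ ε K, StopsAt A c p y0 ε K ∧ accepts A c p y0 K ∧ x = A.iterX p y0 K

/-- NI-APM terminates with `DISAG = FALSE` and returns the cut `∑_{t ∈ S} q t ≤ a`. -/
def NIAPMFalse (p : Alloc T) (y0 : Profile N T) (S : Finset (Fin T)) (a : ℝ) : Prop :=
  ∃ ε K, StopsAt A c p y0 ε K ∧ ¬ accepts A c p y0 K ∧ cutViolated A c p y0 ε K ∧
    S = cutSet A c p y0 ε K ∧ a = cutRhs A c p y0 ε K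

variable (P : Set (Alloc T)) (solve : Set (Alloc T) → Option (Alloc T)) (y0 : ℕ → Profile N T)

/-- In the optimal disaggregation algorithm, iteration `s` is reached with feasible set
`P⁽ˢ⁾ = Q`. The call `solve Q` solves the master problem on `Q` (`none` means infeasible), and the
call of NI-APM at iteration `s` starts from `y0 s`. -/
inductive Reaches : ℕ → Set (Alloc T) → Prop
  | init : Reaches 0 P
  | cut {s : ℕ} {Q : Set (Alloc T)} {p : Alloc T} {S : Finset (Fin T)} {a : ℝ} :
      Reaches s Q → solve Q = some p → NIAPMFalse A c p (y0 s) S a →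
      Reaches (s + 1) (Q ∩ {q | ∑ t ∈ S, q t ≤ a})

/-- NI-APM is called on the allocation `p = p⁽ˢ⁾` at iteration `s`. -/
def Calls (s : ℕ) (p : Alloc T) : Prop :=
  ∃ Q, Reaches A c P solve y0 s Q ∧ solve Q = some p

/-- The algorithm exits at iteration `s` because the master problem is infeasible. -/
def Exits (s : ℕ) : Prop :=
  ∃ Q, Reaches A c P solve y0 s Q ∧ solve Q = none

/-- The algorithm stops at iteration `s` with the allocation `p` and the profiles `x`. -/
def Returns (s : ℕ) (p : Alloc T) (x : Profile N T) : Prop :=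
  Calls A c P solve y0 s p ∧ NIAPMTrue A c p (y0 s) x

/-- The answer of `solve` on `Q` is correct: it reports infeasibility exactly when `Q` is empty,
and otherwise gives a minimizer of `f` over `Q`. -/
def SolvesMaster (f : Alloc T → ℝ) (Q : Set (Alloc T)) : Prop :=
  (solve Q = none ↔ Q = ∅) ∧ ∀ p, solve Q = some p → p ∈ Q ∧ ∀ q ∈ Q, f p ≤ f q

end Algorithm

end Disagg

namespace Disagg

/-! ### Geometric convergence and deviation from the mean. -/

section Geometric

variable {V : Type*} [NormedAddCommGroup V]

/-! The heart is that a returned cut is exact: the current profile maximizes the consumption of `S`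
over all feasible profiles. Let d be the last increment of x, so ‖d‖ < ε when the loop stops. By
optimality of the projection, an agent still able to move consumption from u to t forces ν_t - ν_u ≤
2‖d‖ (`Agents.iterNu_sub_le`). The geometric rate puts ν within qε of its limit, q = ρ/(1-ρ), and
the conditions on B then separate ν on `S` from ν off `S` by more than 2ε (`StopsAt.cutSet_spec`).
So no agent can move consumption into `S`: each sits at its upper bounds on `S` or at its lower
bounds off `S` (`NIAPMFalse.spec`).

Hence a cut keeps every disaggregable allocation, and its right-hand side depends on `S` alone. No
set recurs, because later allocations satisfy the earlier cut; the empty and full sets never give a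
violated cut. This leaves at most 2^T - 2 cuts (`Reaches.invariant`). Each call ends, since endless
failure would force ν → 0, hence x - y → 0 (`niapm_terminates`). The final p minimizes f over a
superset of the disaggregable allocations. -/

theorem exists_tendsto_of_geometric [CompleteSpace V] {u : ℕ → V} {ρ : ℝ} (h0 : 0 < ρ) (h1 : ρ < 1)
    (h : ∀ k, 2 ≤ k → ‖u (k + 1) - u k‖ ≤ ρ * ‖u k - u (k - 1)‖) :
    ∃ a, Tendsto u atTop (𝓝 a) ∧
      ∀ K, 2 ≤ K → ‖u K - a‖ ≤ ρ * ‖u K - u (K - 1)‖ / (1 - ρ) := by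
  -- Anchoring the bound at `K` controls the error by the last increment, the quantity the stopping
  -- test sees.
  have key : ∀ K, 2 ≤ K → ∀ j, dist (u (K + j)) (u (K + (j + 1))) ≤
      ρ * ‖u K - u (K - 1)‖ * ρ ^ j := by
    intro K hK j
    rw [dist_comm, dist_eq_norm]
    induction j with
    | zero => simpa using h K hK
    | succ j ih =>
      refine (h (K + (j + 1)) (by omega)).trans ?_
      calc ρ * ‖u (K + (j + 1)) - u (K + j)‖
          ≤ ρ * (ρ * ‖u K - u (K - 1)‖ * ρ ^ j) := mul_le_mul_of_nonneg_left ih h0.le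
        _ = ρ * ‖u K - u (K - 1)‖ * ρ ^ (j + 1) := by ring
  obtain ⟨a, ha⟩ := cauchySeq_tendsto_of_complete
    (cauchySeq_of_le_geometric (f := fun j => u (2 + j)) _ _ h1 (key 2 le_rfl))
  have hu : Tendsto u atTop (𝓝 a) := by
    rw [← tendsto_add_atTop_iff_nat 2]
    simpa only [add_comm] using ha
  refine ⟨a, hu, fun K hK => ?_⟩
  have hs : Tendsto (fun j => u (K + j)) atTop (𝓝 a) := by
    simpa only [add_comm] using (tendsto_add_atTop_iff_nat K).2 hu
  rw [← dist_eq_norm]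
  exact dist_le_of_le_geometric_of_tendsto₀ (f := fun j => u (K + j)) _ _ h1 (key K hK) hs

/-- The deviation of one value from the mean is at most the Euclidean norm of all values. -/
theorem sub_mean_sq_le {N : ℕ} (hN : 0 < N) (a : Fin N → ℝ) (n : Fin N) :
    (a n - 1 / (N : ℝ) * ∑ i, a i) ^ 2 ≤ ∑ i, a i ^ 2 := by
  have hN' : (N : ℝ) ≠ 0 := by positivity
  set m := 1 / (N : ℝ) * ∑ i, a i with hm
  have hs : ∑ i, a i = N * m := by rw [hm]; field_simp
  -- Variance identity: centring can only decrease the sum of squares.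
  have e : ∑ i, (a i - m) ^ 2 = ∑ i, a i ^ 2 - N * m ^ 2 := by
    simp only [sub_sq, Finset.sum_add_distrib, Finset.sum_sub_distrib, ← Finset.sum_mul,
      ← Finset.mul_sum, hs]
    simp
    ring
  have := Finset.single_le_sum (f := fun i => (a i - m) ^ 2) (fun i _ => sq_nonneg _)
    (Finset.mem_univ n)
  have h2 : 0 ≤ N * m ^ 2 := by positivity
  linarith

end Geometric

/-! ### Projections, ν and the exchange inequality. -/

section Iterates

variable {N T : ℕ} (A : Agents N T)

theorem Agents.indiv_nonempty (n : Fin N) : (A.indiv n).Nonempty := A.nonempty n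

theorem Agents.indiv_isClosed (n : Fin N) : IsClosed (A.indiv n) := by
  have : A.indiv n = {v | ∑ t, v t = A.E n} ∩ ⋂ t, {v | A.lo n t ≤ v t} ∩ {v | v t ≤ A.hi n t} := by
    ext v
    simp [Agents.indiv]
  rw [this]
  refine (isClosed_eq (by fun_prop) continuous_const).inter (isClosed_iInter fun t => ?_)
  exact (isClosed_le continuous_const (by fun_prop)).inter
    (isClosed_le (by fun_prop) continuous_const)

theorem Agents.indiv_convex (n : Fin N) : Convex ℝ (A.indiv n) := by
  rintro v ⟨hv, hv'⟩ w ⟨hw, hw'⟩ a b ha hb hab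
  refine ⟨?_, fun t => ⟨?_, ?_⟩⟩
  · simp only [PiLp.add_apply, PiLp.smul_apply, smul_eq_mul, Finset.sum_add_distrib,
      ← Finset.mul_sum, hv, hw, ← add_mul, hab, one_mul]
  · have h1 := mul_le_mul_of_nonneg_left (hv' t).1 ha
    have h2 := mul_le_mul_of_nonneg_left (hw' t).1 hb
    simp only [PiLp.add_apply, PiLp.smul_apply, smul_eq_mul]
    calc A.lo n t = a * A.lo n t + b * A.lo n t := by rw [← add_mul, hab, one_mul]
      _ ≤ _ := add_le_add h1 h2
  · have h1 := mul_le_mul_of_nonneg_left (hv' t).2 ha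
    have h2 := mul_le_mul_of_nonneg_left (hw' t).2 hb
    simp only [PiLp.add_apply, PiLp.smul_apply, smul_eq_mul]
    calc _ ≤ a * A.hi n t + b * A.hi n t := add_le_add h1 h2
      _ = A.hi n t := by rw [← add_mul, hab, one_mul]

theorem Agents.proj_indiv_spec (n : Fin N) (v : Alloc T) :
    proj (A.indiv n) v ∈ A.indiv n ∧ ∀ z ∈ A.indiv n, ‖v - proj (A.indiv n) v‖ ≤ ‖v - z‖ :=
  proj_spec (A.indiv_nonempty n) (A.indiv_isClosed n).isComplete (A.indiv_convex n) v

theorem Agents.iterX_mem (p : Alloc T) (y0 : Profile N T) (k : ℕ) : A.iterX p y0 k ∈ A.feasible :=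
  fun n => (A.proj_indiv_spec n _).1

theorem Agents.proj_indiv_inner_le (n : Fin N) (v z : Alloc T) (hz : z ∈ A.indiv n) :
    inner ℝ (v - proj (A.indiv n) v) (z - proj (A.indiv n) v) ≤ 0 := by
  obtain ⟨hm, hle⟩ := A.proj_indiv_spec n v
  refine (norm_eq_iInf_iff_real_inner_le_zero (A.indiv_convex n) hm).1 ?_ z hz
  have : Nonempty (A.indiv n) := ⟨⟨z, hz⟩⟩
  exact le_antisymm (le_ciInf fun w => hle w w.2)
    (ciInf_le ⟨0, by rintro _ ⟨x, rfl⟩; exact norm_nonneg _⟩ (⟨_, hm⟩ : A.indiv n))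

/-- The exchange inequality satisfied by the projection onto an individual feasibility set. -/
theorem Agents.proj_indiv_exchange (n : Fin N) (v : Alloc T) {t u : Fin T}
    (htu : t ≠ u) (ht : proj (A.indiv n) v t < A.hi n t) (hu : A.lo n u < proj (A.indiv n) v u) :
    v t - proj (A.indiv n) v t ≤ v u - proj (A.indiv n) v u := by
  obtain ⟨hm, -⟩ := A.proj_indiv_spec n v
  have hin := A.proj_indiv_inner_le n v
  set x := proj (A.indiv n) v
  -- The largest transfer from `u` to `t` that both bounds allow. Testing optimality of the
  -- projection against it and cancelling `δ > 0` gives the claim.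
  set δ := min (A.hi n t - x t) (x u - A.lo n u)
  have hδ : 0 < δ := lt_min (sub_pos.2 ht) (sub_pos.2 hu)
  have h1 : δ ≤ A.hi n t - x t := min_le_left _ _
  have h2 : δ ≤ x u - A.lo n u := min_le_right _ _
  set e : Alloc T := EuclideanSpace.single t δ - EuclideanSpace.single u δ with he
  have hz : x + e ∈ A.indiv n := by
    refine ⟨?_, fun i => ?_⟩
    · simp [he, Finset.sum_add_distrib, Finset.sum_sub_distrib, hm.1]
    · have := hm.2 i
      by_cases hit : i = t
      · subst hit
        simp [he, htu]
        constructor <;> linarith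
      · by_cases hiu : i = u
        · subst hiu
          simp [he, hit]
          constructor <;> linarith
        · simpa [he, hit, hiu] using this
  have := hin _ hz
  rw [add_sub_cancel_left, he, inner_sub_right, EuclideanSpace.inner_single_right,
    EuclideanSpace.inner_single_right] at this
  simp at this
  nlinarith

theorem abs_apply_le_norm (z : Profile N T) (n : Fin N) (t : Fin T) : |z n t| ≤ ‖z‖ :=
  (PiLp.norm_apply_le (z n) t).trans (PiLp.norm_apply_le z n)

theorem sum_sq_apply_le (z : Profile N T) (t : Fin T) : ∑ n, (z n t) ^ 2 ≤ ‖z‖ ^ 2 := by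
  rw [PiLp.norm_sq_eq_of_L2]
  refine Finset.sum_le_sum fun n _ => ?_
  rw [← sq_abs]
  exact pow_le_pow_left₀ (abs_nonneg _) (PiLp.norm_apply_le (z n) t) 2

theorem nu_sub_apply (p : Alloc T) (x x' : Profile N T) (t : Fin T) :
    nu p x t - nu p x' t = 1 / (N : ℝ) * ∑ n, (x' - x) n t := by
  simp [nu, Finset.sum_sub_distrib]
  ring

theorem abs_nu_sub_le (hN : 0 < N) (p : Alloc T) (x x' : Profile N T) (t : Fin T) :
    |nu p x t - nu p x' t| ≤ ‖x - x'‖ := by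
  have hN' : (0 : ℝ) < N := by positivity
  rw [nu_sub_apply, abs_mul, abs_of_pos (by positivity), one_div, inv_mul_le_iff₀ hN']
  refine (Finset.abs_sum_le_sum_abs _ _).trans
    ((Finset.sum_le_sum fun n _ => abs_apply_le_norm _ n t).trans ?_)
  simp [norm_sub_rev]

theorem continuous_nu (p : Alloc T) : Continuous (fun x : Profile N T => nu p x) := by
  unfold nu
  fun_prop

theorem sum_nu (hN : 0 < N) (p : Alloc T) (x : Profile N T) (t : Fin T) :
    (N : ℝ) * nu p x t = p t - ∑ n, x n t := by
  have hN' : (N : ℝ) ≠ 0 := by positivity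
  simp [nu]
  field_simp

theorem Agents.iterY_eq (p : Alloc T) (y0 : Profile N T) {k : ℕ} (hk : 1 ≤ k) :
    A.iterY p y0 k = aggStep p (A.iterX p y0 k) := by
  obtain ⟨k, rfl⟩ := Nat.exists_eq_add_of_le' hk
  simp [Agents.iterY, Agents.iterX, Function.iterate_succ_apply']

theorem Agents.iterX_eq (p : Alloc T) (y0 : Profile N T) {k : ℕ} (hk : 2 ≤ k) (n : Fin N) :
    A.iterX p y0 k n =
      proj (A.indiv n) (A.iterX p y0 (k - 1) n + A.iterNu p y0 (k - 1)) := by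
  rw [Agents.iterX, A.iterY_eq p y0 (by omega : 1 ≤ k - 1)]
  rfl

theorem aggStep_mem (hN : 0 < N) (p : Alloc T) (x : Profile N T) :
    aggStep p x ∈ aggregating N p := by
  intro t
  have := sum_nu hN p x t
  simp [aggStep, Finset.sum_add_distrib]
  linarith

theorem sum_nu_feasible (hN : 0 < N) {p : Alloc T} (hp : A.aggCond p) {x : Profile N T}
    (hx : x ∈ A.feasible) : ∑ t, nu p x t = 0 := by
  have hN' : (N : ℝ) ≠ 0 := by positivity
  have h : (N : ℝ) * ∑ t, nu p x t = 0 := by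
    rw [Finset.mul_sum]
    simp only [sum_nu hN]
    rw [Finset.sum_sub_distrib, Finset.sum_comm, hp.1, sub_eq_zero]
    exact Finset.sum_congr rfl fun n _ => (hx n).1.symm
  exact (mul_eq_zero.1 h).resolve_left hN'

/-- Between two consecutive iterates, the exchange inequality in terms of the current `ν`. -/
theorem Agents.iterNu_sub_le (hN : 0 < N) (p : Alloc T) (y0 : Profile N T) {k : ℕ} (hk : 2 ≤ k)
    (n : Fin N) {t u : Fin T} (htu : t ≠ u) (ht : A.iterX p y0 k n t < A.hi n t)
    (hu : A.lo n u < A.iterX p y0 k n u) :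
    A.iterNu p y0 k t - A.iterNu p y0 k u ≤
      2 * ‖A.iterX p y0 k - A.iterX p y0 (k - 1)‖ := by
  have h := A.iterX_eq p y0 hk n
  rw [h] at ht hu
  have hex := A.proj_indiv_exchange n _ htu ht hu
  rw [← h] at hex
  simp only [PiLp.add_apply] at hex
  set d := A.iterX p y0 k - A.iterX p y0 (k - 1) with hd
  -- ν changes by minus the mean of d over the agents, so only deviations from that mean enter.
  -- Bounding d and its mean separately would give the constant 4 instead of 2.
  have key : ∀ i, |d n i - 1 / (N : ℝ) * ∑ m, d m i| ≤ ‖d‖ := fun i =>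
    abs_le_of_sq_le_sq ((sub_mean_sq_le hN (fun m => d m i) n).trans (sum_sq_apply_le d i))
      (norm_nonneg _)
  have h2 : ∀ i, A.iterNu p y0 (k - 1) i - A.iterNu p y0 k i = 1 / (N : ℝ) * ∑ m, d m i :=
    fun i => nu_sub_apply p _ _ i
  have h3 : ∀ i, d n i = A.iterX p y0 k n i - A.iterX p y0 (k - 1) n i := fun i => by simp [hd]
  have k1 := (abs_le.1 (key t)).2
  have k2 := (abs_le.1 (key u)).1
  rw [← h2, h3] at k1 k2
  linarith

end Iterates

/-! ### Exactness of the cuts and termination of NI-APM. -/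

section Calls

variable {N T : ℕ} (A : Agents N T) (c : Params N T)

/-- The data at the limit of the alternate projections under the assumptions on the parameters. -/
theorem Agents.ParamsOK.exists_limit {A : Agents N T} (hN : 0 < N) {p : Alloc T} {y0 : Profile N T}
    {B ε : ℝ} (h : A.ParamsOK p y0 B ε) :
    ∃ xinf, Tendsto (A.iterX p y0) atTop (𝓝 xinf) ∧
      (∀ t, nu p xinf t ≠ 0 → ε * (2 * B) < |nu p xinf t|) ∧
      ∃ q, 0 ≤ q ∧ 1 + q < B ∧ ∀ K, 2 ≤ K → ∀ t, |A.iterNu p y0 K t - nu p xinf t| ≤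
        q * ‖A.iterX p y0 K - A.iterX p y0 (K - 1)‖ := by
  obtain ⟨⟨ρ, ⟨h0, h1, hr⟩, hB⟩, hν⟩ := h
  obtain ⟨xinf, hx, hK⟩ := exists_tendsto_of_geometric h0 h1 fun k hk => (hr k hk).1
  have h1' : 0 < 1 - ρ := sub_pos.2 h1
  -- With this q, 1 + q = 1/(1 - ρ), so the condition on B reads 1 + q < B.
  refine ⟨xinf, hx, hν _ (((continuous_nu p).tendsto xinf).comp hx), ρ / (1 - ρ),
    by positivity, ?_, fun K hK2 t => ?_⟩
  · have : 1 + ρ / (1 - ρ) = 1 / (1 - ρ) := by field_simp; ring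
    rwa [this]
  · refine (abs_nu_sub_le hN p _ _ t).trans ((hK K hK2).trans_eq ?_)
    ring

/-- Halving keeps ε at most `c.εcvg`, so the gap assumed at the initial tolerance serves every
round. -/
theorem StopsAt.spec {A : Agents N T} {c : Params N T} (hcvg : 0 < c.εcvg) {p : Alloc T}
    {y0 : Profile N T} {ε : ℝ} {K : ℕ} (h : StopsAt A c p y0 ε K) :
    0 < ε ∧ ε ≤ c.εcvg ∧ 2 ≤ K ∧ c.nrm (A.iterX p y0 K - A.iterX p y0 (K - 1)) < ε := by
  induction h with
  | first h => exact ⟨hcvg, le_rfl, h.1.1, h.1.2⟩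
  | retry _ _ _ h ih =>
    exact ⟨by linarith [ih.1], by linarith [ih.1, ih.2.1], by have := h.1.1; omega, h.1.2⟩

/-- When the loop is left, the computed set consists of the resources at which the limit of `ν` is
positive, and `ν` separates this set from its complement. -/
theorem StopsAt.cutSet_spec {A : Agents N T} {c : Params N T} (hcvg : 0 < c.εcvg)
    (hnrm : ∀ z : Profile N T, ‖z‖ ≤ c.nrm z) {p : Alloc T} {y0 xinf : Profile N T} {q : ℝ}
    (hinf : ∀ t, nu p xinf t ≠ 0 → c.εcvg * (2 * c.B) < |nu p xinf t|) (hq : 0 ≤ q)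
    (hqB : 1 + q < c.B) (hlim : ∀ K, 2 ≤ K → ∀ t, |A.iterNu p y0 K t - nu p xinf t| ≤
        q * ‖A.iterX p y0 K - A.iterX p y0 (K - 1)‖)
    {ε : ℝ} {K : ℕ} (h : StopsAt A c p y0 ε K) :
    (∀ t ∈ cutSet A c p y0 ε K, 0 < nu p xinf t ∧ (2 + q) * ε < A.iterNu p y0 K t) ∧
      (∀ t ∉ cutSet A c p y0 ε K, nu p xinf t ≤ 0 ∧ A.iterNu p y0 K t ≤ q * ε) := by
  obtain ⟨hε, hεc, hK, hd⟩ := h.spec hcvg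
  have hb : ∀ t, |A.iterNu p y0 K t - nu p xinf t| ≤ q * ε := fun t =>
    (hlim K hK t).trans (mul_le_mul_of_nonneg_left ((hnrm _).trans hd.le) hq)
  have hBε : (1 + q) * ε < c.B * ε := mul_lt_mul_of_pos_right hqB hε
  have hB : 0 < c.B := by linarith
  have hεB : ε * (2 * c.B) ≤ c.εcvg * (2 * c.B) := mul_le_mul_of_nonneg_right hεc (by linarith)
  constructor
  · intro t ht
    have ht' : c.B * ε < A.iterNu p y0 K t := by simpa [cutSet] using ht
    have := abs_le.1 (hb t)
    -- Since Bε > qε, the limit is positive. The gap then lifts it above 2Bε > (2 + 2q)ε, and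
    -- returning to ν costs at most qε.
    have hpos : 0 < nu p xinf t := by linarith
    have h2 := hinf t hpos.ne'
    rw [abs_of_pos hpos] at h2
    exact ⟨hpos, by linarith⟩
  · intro t ht
    have ht' : A.iterNu p y0 K t ≤ c.B * ε := by simpa [cutSet] using ht
    have := abs_le.1 (hb t)
    -- A positive limit would exceed 2Bε, but here it is at most Bε + qε < 2Bε.
    have hle : nu p xinf t ≤ 0 := by
      by_contra! hpos
      have h2 := hinf t hpos.ne'
      rw [abs_of_pos hpos] at h2
      linarith
    exact ⟨hle, by linarith⟩

/-- The total is fixed at `A.E n`, so consuming least off `S` means consuming most on `S`. -/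
theorem Agents.sum_le_of_extreme {n : Fin N} {S : Finset (Fin T)} {v w : Alloc T}
    (hv : v ∈ A.indiv n) (hw : w ∈ A.indiv n)
    (h : (∀ t ∈ S, v t = A.hi n t) ∨ ∀ t ∉ S, v t = A.lo n t) :
    ∑ t ∈ S, w t ≤ ∑ t ∈ S, v t := by
  rcases h with h | h
  · exact Finset.sum_le_sum fun t ht => (hw.2 t).2.trans_eq (h t ht).symm
  · have h1 := Finset.sum_add_sum_compl S fun t => v t
    have h2 := Finset.sum_add_sum_compl S fun t => w t
    have h3 : ∑ t ∈ Sᶜ, v t ≤ ∑ t ∈ Sᶜ, w t := Finset.sum_le_sum fun t ht =>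
      (h t (Finset.mem_compl.1 ht)).trans_le (hw.2 t).1
    have := hv.1
    have := hw.1
    linarith

/-- The value `a` is the largest consumption of the resources in `S` by a feasible profile. -/
def Agents.IsCutValue (S : Finset (Fin T)) (a : ℝ) : Prop :=
  IsGreatest ((fun x : Profile N T => ∑ t ∈ S, ∑ n, x n t) '' A.feasible) a

/-- A cut returned by NI-APM is tight, violated by `p`, and given by a nontrivial set. -/
theorem NIAPMFalse.spec {A : Agents N T} {c : Params N T} (hN : 0 < N) (hcvg : 0 < c.εcvg)
    (hnrm : ∀ z : Profile N T, ‖z‖ ≤ c.nrm z) {p : Alloc T} (hp : A.aggCond p) {y0 : Profile N T}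
    (hpar : A.ParamsOK p y0 c.B c.εcvg) {S : Finset (Fin T)} {a : ℝ}
    (h : NIAPMFalse A c p y0 S a) :
    S ≠ ∅ ∧ S ≠ Finset.univ ∧ a < ∑ t ∈ S, p t ∧ A.IsCutValue S a := by
  obtain ⟨ε, K, hs, -, hviol, hS, ha⟩ := h
  obtain ⟨xinf, -, hinf, q, hq, hqB, hlim⟩ := hpar.exists_limit hN
  obtain ⟨hε, hεc, hK, hd⟩ := hs.spec hcvg
  obtain ⟨hin, hout⟩ := hs.cutSet_spec hcvg hnrm hinf hq hqB hlim
  have hmem := A.iterX_mem p y0 K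
  rw [cutViolated, ← ha, ← hS, sub_neg] at hviol
  rw [cutRhs, ← hS] at ha
  rw [← hS] at hin hout
  refine ⟨?_, ?_, hviol, ⟨_, hmem, ha.symm⟩, ?_⟩
  -- Trivial sets cannot be violated: both sides are 0 on the empty set and the total demand on the
  -- full one.
  · rintro rfl
    simp [ha] at hviol
  · rintro rfl
    rw [ha, Finset.sum_comm, hp.1] at hviol
    exact hviol.ne (Finset.sum_congr rfl fun n _ => (hmem n).1)
  · rintro _ ⟨x, hx, rfl⟩
    rw [ha]
    simp only
    rw [Finset.sum_comm, Finset.sum_comm (s := S)]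
    refine Finset.sum_le_sum fun n _ => A.sum_le_of_extreme (hmem n) (hx n) ?_
    -- Otherwise the agent can raise some t in `S` and lower some u off `S`, so their ν gap is below
    -- 2ε, against (2 + q)ε - qε.
    by_contra! hcon
    obtain ⟨⟨t, ht, hte⟩, u, hu, hue⟩ := hcon
    have htu : t ≠ u := fun e => hu (e ▸ ht)
    have h1 := A.iterNu_sub_le hN p y0 hK n htu (lt_of_le_of_ne ((hmem n).2 t).2 hte)
      (lt_of_le_of_ne ((hmem n).2 u).1 hue.symm)
    have h2 := (hin t ht).2
    have h3 := (hout u hu).2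
    have h4 := (hnrm _).trans_lt hd
    linarith

theorem seminorm_continuous (r : Seminorm ℝ (Profile N T)) : Continuous r :=
  r.convexOn.locallyLipschitz.continuous

theorem exists_loopStops {p : Alloc T} {y0 xinf : Profile N T}
    (hx : Tendsto (A.iterX p y0) atTop (𝓝 xinf)) {ε : ℝ} (hε : 0 < ε) (k : ℕ) :
    ∃ K, LoopStops A c p y0 ε k K := by
  have h1 : Tendsto (fun K => A.iterX p y0 K - A.iterX p y0 (K - 1)) atTop (𝓝 (xinf - xinf)) :=
    hx.sub (hx.comp (tendsto_sub_atTop_nat 1))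
  have h2 := ((seminorm_continuous c.nrm).tendsto _).comp h1
  rw [sub_self, map_zero] at h2
  obtain ⟨K, hK, hK'⟩ := ((h2.eventually (gt_mem_nhds hε)).and (eventually_gt_atTop k)).exists
  exact ⟨_, isLeast_csInf ⟨K, hK', hK⟩⟩

/-- A nonempty computed set gives a violated cut. -/
theorem StopsAt.cutViolated_of_nonempty {A : Agents N T} {c : Params N T} (hN : 0 < N)
    (hcvg : 0 < c.εcvg) (hB : 0 < c.B) {p : Alloc T} {y0 : Profile N T} {ε : ℝ} {K : ℕ}
    (h : StopsAt A c p y0 ε K) (hne : (cutSet A c p y0 ε K).Nonempty) :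
    cutViolated A c p y0 ε K := by
  obtain ⟨hε, -⟩ := h.spec hcvg
  rw [cutViolated, cutRhs, sub_neg]
  refine Finset.sum_lt_sum_of_nonempty hne fun t ht => ?_
  have ht' : c.B * ε < A.iterNu p y0 K t := by simpa [cutSet] using ht
  have h1 := sum_nu hN p (A.iterX p y0 K) t
  have h2 : 0 < (N : ℝ) * nu p (A.iterX p y0 K) t :=
    mul_pos (by positivity) ((mul_pos hB hε).trans ht')
  linarith

/-- NI-APM terminates. -/
theorem niapm_terminates (hN : 0 < N) (hcvg : 0 < c.εcvg) (hdis : 0 < c.εdis)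
    (hnrm : ∀ z : Profile N T, ‖z‖ ≤ c.nrm z) {p : Alloc T} (hp : A.aggCond p) {y0 : Profile N T}
    (hpar : A.ParamsOK p y0 c.B c.εcvg) :
    (∃ x, NIAPMTrue A c p y0 x) ∨ ∃ S a, NIAPMFalse A c p y0 S a := by
  obtain ⟨xinf, hx, hinf, q, hq, hqB, hlim⟩ := hpar.exists_limit hN
  by_contra! hcon
  obtain ⟨hT, hF⟩ := hcon
  have hacc : ∀ ε K, StopsAt A c p y0 ε K → ¬ accepts A c p y0 K :=
    fun ε K h h' => hT _ ⟨ε, K, h, h', rfl⟩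
  have hvio : ∀ ε K, StopsAt A c p y0 ε K → ¬ cutViolated A c p y0 ε K :=
    fun ε K h h' => hF _ _ ⟨ε, K, h, hacc ε K h, h', rfl, rfl⟩
  -- Each failed round advances the iterate strictly, so stops occur arbitrarily late.
  have hlarge : ∀ m, ∃ ε K, m ≤ K ∧ StopsAt A c p y0 ε K := by
    intro m
    induction m with
    | zero =>
      obtain ⟨K, hK⟩ := exists_loopStops A c hx hcvg 1
      exact ⟨_, K, Nat.zero_le _, .first hK⟩
    | succ m ih =>
      obtain ⟨ε, K, hm, hs⟩ := ih
      obtain ⟨K', hK'⟩ := exists_loopStops A c hx (half_pos (hs.spec hcvg).1) K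
      have : K < K' := hK'.1.1
      exact ⟨_, K', by omega, .retry hs (hacc ε K hs) (hvio ε K hs) hK'⟩
  -- With no violated cut the computed set is empty, so the limit of ν is nonpositive; equality of
  -- total demands makes its entries sum to zero.
  have hnu : nu p xinf = 0 := by
    obtain ⟨ε, K, -, hs⟩ := hlarge 0
    obtain ⟨hin, hout⟩ := hs.cutSet_spec hcvg hnrm hinf hq hqB hlim
    have hempty : cutSet A c p y0 ε K = ∅ := by
      rw [← Finset.not_nonempty_iff_eq_empty]
      exact fun hne => hvio ε K hs (hs.cutViolated_of_nonempty hN hcvg (by linarith) hne)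
    have hle : ∀ t ∈ Finset.univ, nu p xinf t ≤ 0 := fun t _ => (hout t (by simp [hempty])).1
    have hfeas : xinf ∈ A.feasible := fun n =>
      (A.indiv_isClosed n).mem_of_tendsto
        (((PiLp.continuous_apply 2 _ n).tendsto xinf).comp hx)
        (Eventually.of_forall fun k => A.iterX_mem p y0 k n)
    have h0 := (Finset.sum_eq_zero_iff_of_nonpos hle).1 (sum_nu_feasible A hN hp hfeas)
    ext t
    exact h0 t (Finset.mem_univ t)
  have hcont : Continuous fun x : Profile N T => c.nrm (x - aggStep p x) := by
    refine (seminorm_continuous c.nrm).comp (continuous_id.sub ?_)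
    unfold aggStep
    have := continuous_nu (N := N) p
    fun_prop
  have hlim0 := (hcont.tendsto xinf).comp hx
  have hz : aggStep p xinf = xinf := by
    ext n t
    simp [aggStep, hnu]
  simp only [hz, sub_self, map_zero] at hlim0
  obtain ⟨m, hm⟩ := eventually_atTop.1 (hlim0.eventually (gt_mem_nhds hdis))
  obtain ⟨ε, K, hmK, hs⟩ := hlarge m
  refine hacc ε K hs ?_
  rw [accepts, A.iterY_eq p y0 (by have := (hs.spec hcvg).2.2.1; omega)]
  exact (hm K hmK).le

/-- Profiles returned by NI-APM are feasible and close to a profile aggregating to `p`. -/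
theorem NIAPMTrue.spec {A : Agents N T} {c : Params N T} (hN : 0 < N) (hcvg : 0 < c.εcvg)
    {p : Alloc T} {y0 x : Profile N T} (h : NIAPMTrue A c p y0 x) :
    x ∈ A.feasible ∧ ∃ y ∈ aggregating N p, c.nrm (x - y) ≤ c.εdis := by
  obtain ⟨ε, K, hs, hacc, rfl⟩ := h
  refine ⟨A.iterX_mem p y0 K, _, ?_, hacc⟩
  rw [A.iterY_eq p y0 (by have := (hs.spec hcvg).2.2.1; omega)]
  exact aggStep_mem hN p _

end Calls

/-! ### Counting the cuts of the master problem. -/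

section Master

variable {N T : ℕ} {A : Agents N T} {c : Params N T} {P : Set (Alloc T)}
  {solve : Set (Alloc T) → Option (Alloc T)} {y0 : ℕ → Profile N T}

theorem Reaches.subset {s : ℕ} {Q : Set (Alloc T)} (h : Reaches A c P solve y0 s Q) : Q ⊆ P := by
  induction h with
  | init => exact subset_rfl
  | cut _ _ _ ih => exact Set.inter_subset_left.trans ih

/-- The cuts keep the disaggregable allocations, and come from distinct nontrivial sets. -/
theorem Reaches.invariant (hcut : ∀ s Q p S a, Reaches A c P solve y0 s Q → solve Q = some p →
      NIAPMFalse A c p (y0 s) S a →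
      p ∈ Q ∧ S ≠ ∅ ∧ S ≠ Finset.univ ∧ a < ∑ t ∈ S, p t ∧ A.IsCutValue S a)
    {s : ℕ} {Q : Set (Alloc T)} (h : Reaches A c P solve y0 s Q) :
    A.disaggregable P ⊆ Q ∧ ∃ F : Finset (Finset (Fin T)), F.card = s ∧
      ∀ S ∈ F, S ≠ ∅ ∧ S ≠ Finset.univ ∧
        ∀ a, A.IsCutValue S a → ∀ q ∈ Q, ∑ t ∈ S, q t ≤ a := by
  classical
  induction h with
  | init => exact ⟨fun _ hp => hp.1, ∅, by simp⟩
  | @cut s Q p S a hr hp hF ih =>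
    obtain ⟨hsub, F, hcard, hFS⟩ := ih
    obtain ⟨hpQ, hS0, hS1, hlt, hval⟩ := hcut s Q p S a hr hp hF
    refine ⟨Set.subset_inter hsub ?_, insert S F, ?_, ?_⟩
    · rintro _ ⟨-, x, hx, rfl⟩
      exact hval.2 ⟨x, hx, by simp⟩
    · rw [Finset.card_insert_of_notMem, hcard]
      -- If `S` had been used before, `p ∈ Q` would satisfy the same cut, which it violates.
      exact fun hmem => (hlt.trans_le ((hFS S hmem).2.2 a hval p hpQ)).false
    · intro S' hS'
      rcases Finset.mem_insert.1 hS' with rfl | hS'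
      · exact ⟨hS0, hS1, fun b hb q hq => hb.unique hval ▸ hq.2⟩
      · obtain ⟨h0, h1, h2⟩ := hFS S' hS'
        exact ⟨h0, h1, fun b hb q hq => h2 b hb q hq.1⟩

theorem card_nontrivial_le (hT : 0 < T) (F : Finset (Finset (Fin T)))
    (hF : ∀ S ∈ F, S ≠ ∅ ∧ S ≠ Finset.univ) : F.card ≤ 2 ^ T - 2 := by
  classical
  have hne : (∅ : Finset (Fin T)) ≠ Finset.univ := fun h =>
    Finset.notMem_empty (⟨0, hT⟩ : Fin T) (h ▸ Finset.mem_univ _)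
  have hsub : F ⊆ Finset.univ \ {∅, Finset.univ} := fun S hS => by
    simpa [not_or] using hF S hS
  refine (Finset.card_le_card hsub).trans_eq ?_
  rw [Finset.card_sdiff_of_subset (Finset.subset_univ _), Finset.card_pair hne]
  simp

/-- Without resources a positive demand would be an empty sum. -/
theorem Agents.pos_of_pos (A : Agents N T) (hN : 0 < N) : 0 < T := by
  rcases Nat.eq_zero_or_pos T with rfl | h
  · obtain ⟨v, hv, -⟩ := A.nonempty ⟨0, hN⟩
    have := A.E_pos ⟨0, hN⟩
    simp at hv
    linarith
  · exact h

/-- The algorithm stops within `2 ^ T - 2` cuts. -/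
theorem exists_exits_or_returns (hT : 0 < T)
    (hcut : ∀ s Q p S a, Reaches A c P solve y0 s Q → solve Q = some p →
      NIAPMFalse A c p (y0 s) S a →
      p ∈ Q ∧ S ≠ ∅ ∧ S ≠ Finset.univ ∧ a < ∑ t ∈ S, p t ∧ A.IsCutValue S a)
    (hterm : ∀ s p, Calls A c P solve y0 s p →
      (∃ x, NIAPMTrue A c p (y0 s) x) ∨ ∃ S a, NIAPMFalse A c p (y0 s) S a) :
    ∃ s ≤ 2 ^ T - 2, Exits A c P solve y0 s ∨ ∃ p x, Returns A c P solve y0 s p x := by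
  have hle : ∀ s Q, Reaches A c P solve y0 s Q → s ≤ 2 ^ T - 2 := by
    intro s Q h
    obtain ⟨-, F, rfl, hF⟩ := h.invariant hcut
    exact card_nontrivial_le hT F fun S hS => ⟨(hF S hS).1, (hF S hS).2.1⟩
  by_contra! hcon
  have hall : ∀ s, ∃ Q, Reaches A c P solve y0 s Q := by
    intro s
    induction s with
    | zero => exact ⟨P, .init⟩
    | succ s ih =>
      obtain ⟨Q, hQ⟩ := ih
      obtain ⟨hex, hret⟩ := hcon s (hle s Q hQ)
      cases hp : solve Q with
      | none => exact (hex ⟨Q, hQ, hp⟩).elim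
      | some p =>
        rcases hterm s p ⟨Q, hQ, hp⟩ with ⟨x, hx⟩ | ⟨S, a, hS⟩
        · exact (hret p x ⟨⟨Q, hQ, hp⟩, hx⟩).elim
        · exact ⟨_, .cut hQ hp hS⟩
  obtain ⟨Q, hQ⟩ := hall (2 ^ T - 2 + 1)
  have := hle _ Q hQ
  omega

/-- Lets the accepted bound `c.εdis` be multiplied by `κ`; a nonzero profile decides the sign. -/
theorem nonneg_of_seminorm_sum_le (hN : 0 < N) (hT : 0 < T)
    (hnrm : ∀ z : Profile N T, ‖z‖ ≤ c.nrm z) {r : Seminorm ℝ (Alloc T)} {κ : ℝ}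
    (hκ : ∀ z : Profile N T, r (∑ n, z n) ≤ κ * c.nrm z) : 0 ≤ κ := by
  have : Nontrivial (Profile N T) := by
    have : Nonempty (Fin N) := ⟨⟨0, hN⟩⟩
    have : Nonempty (Fin T) := ⟨⟨0, hT⟩⟩
    infer_instance
  obtain ⟨z, hz⟩ := exists_ne (0 : Profile N T)
  have h1 : 0 < c.nrm z := (norm_pos_iff.2 hz).trans_le (hnrm z)
  exact nonneg_of_mul_nonneg_left ((apply_nonneg r _).trans (hκ z)) h1

theorem sum_sub_of_mem_aggregating {p : Alloc T} {x y : Profile N T}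
    (hy : y ∈ aggregating N p) : ∑ n, (x - y) n = ∑ n, x n - p := by
  ext t
  simp [Finset.sum_sub_distrib, hy t]

end Master

end Disagg

theorem mainTheorem3 {N T : ℕ} (hN : 0 < N) (A : Disagg.Agents N T)
    (P : Set (Disagg.Alloc T)) (hP : ∀ p ∈ P, A.aggCond p)
    (f : Disagg.Alloc T → ℝ)
    (c : Disagg.Params N T) (hcvg : 0 < c.εcvg) (hdis : 0 < c.εdis)
    (hnrm : ∀ z : Disagg.Profile N T, ‖z‖ ≤ c.nrm z)
    (nrmT : Seminorm ℝ (Disagg.Alloc T)) (κ : ℝ)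
    (hκ : ∀ z : Disagg.Profile N T, nrmT (∑ n, z n) ≤ κ * c.nrm z)
    (solve : Set (Disagg.Alloc T) → Option (Disagg.Alloc T))
    (y0 : ℕ → Disagg.Profile N T)
    (hsolve : ∀ s Q, Disagg.Reaches A c P solve y0 s Q → Disagg.SolvesMaster solve f Q)
    (hparams : ∀ s p, Disagg.Calls A c P solve y0 s p → A.ParamsOK p (y0 s) c.B c.εcvg) :
    -- the global problem is infeasible
    (A.disaggregable P = ∅ →
      (∃ s ≤ 2 ^ T - 2, Disagg.Exits A c P solve y0 s ∨
        ∃ p x, Disagg.Returns A c P solve y0 s p x ∧ p ∈ P ∧ (∀ n, x n ∈ A.indiv n) ∧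
          nrmT (∑ n, x n - p) ≤ κ * c.εdis) ∧
      ((∀ s p, Disagg.Calls A c P solve y0 s p →
          ∀ x ∈ A.feasible, ∀ y ∈ Disagg.aggregating N p, c.εdis < c.nrm (x - y)) →
        ∃ s ≤ 2 ^ T - 2, Disagg.Exits A c P solve y0 s)) ∧
    -- the global problem is feasible
    ((A.disaggregable P).Nonempty →
      ∃ s ≤ 2 ^ T - 2, ∃ p x, Disagg.Returns A c P solve y0 s p x ∧
        p ∈ P ∧ (∀ n, x n ∈ A.indiv n) ∧ nrmT (∑ n, x n - p) ≤ κ * c.εdis ∧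
        BddBelow (f '' A.disaggregable P) ∧ f p ≤ sInf (f '' A.disaggregable P)) := by
  have hT : 0 < T := A.pos_of_pos hN
  have hκ0 : 0 ≤ κ := Disagg.nonneg_of_seminorm_sum_le hN hT hnrm hκ
  have hmem : ∀ s Q p, Disagg.Reaches A c P solve y0 s Q → solve Q = some p → p ∈ Q :=
    fun s Q p hQ hp => ((hsolve s Q hQ).2 p hp).1
  have hagg : ∀ s p, Disagg.Calls A c P solve y0 s p → p ∈ P :=
    fun s p ⟨Q, hQ, hp⟩ => hQ.subset (hmem s Q p hQ hp)
  have hcut : ∀ s Q p S a, Disagg.Reaches A c P solve y0 s Q → solve Q = some p →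
      Disagg.NIAPMFalse A c p (y0 s) S a →
      p ∈ Q ∧ S ≠ ∅ ∧ S ≠ Finset.univ ∧ a < ∑ t ∈ S, p t ∧ A.IsCutValue S a :=
    fun s Q p S a hQ hp hF => ⟨hmem s Q p hQ hp, hF.spec hN hcvg hnrm
      (hP p (hagg s p ⟨Q, hQ, hp⟩)) (hparams s p ⟨Q, hQ, hp⟩)⟩
  have hret : ∀ s p x, Disagg.Returns A c P solve y0 s p x →
      p ∈ P ∧ (∀ n, x n ∈ A.indiv n) ∧ nrmT (∑ n, x n - p) ≤ κ * c.εdis := by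
    rintro s p x ⟨hc, hx⟩
    obtain ⟨hfeas, y, hy, hxy⟩ := hx.spec hN hcvg
    refine ⟨hagg s p hc, hfeas, ?_⟩
    rw [← Disagg.sum_sub_of_mem_aggregating hy]
    exact (hκ _).trans (mul_le_mul_of_nonneg_left hxy hκ0)
  obtain ⟨s, hs, hends⟩ := Disagg.exists_exits_or_returns hT hcut fun s p hc =>
    Disagg.niapm_terminates A c hN hcvg hdis hnrm (hP p (hagg s p hc)) (hparams s p hc)
  refine ⟨fun _ => ⟨⟨s, hs, hends.imp_right fun ⟨p, x, h⟩ => ⟨p, x, h, hret s p x h⟩⟩,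
    fun hfar => ⟨s, hs, hends.resolve_right ?_⟩⟩, fun hne => ?_⟩
  · rintro ⟨p, x, hc, hx⟩
    obtain ⟨hfeas, y, hy, hxy⟩ := hx.spec hN hcvg
    exact (hfar s p hc x hfeas y hy).not_ge hxy
  · rcases hends with ⟨Q, hQ, hnone⟩ | ⟨p, x, h⟩
    · obtain ⟨q, hq⟩ := hne
      -- Exiting is impossible: the cuts never removed the disaggregable `q`.
      have hqQ := (hQ.invariant hcut).1 hq
      rw [(hsolve s Q hQ).1.1 hnone] at hqQ
      exact hqQ.elim
    · obtain ⟨h1, h2, h3⟩ := hret s p x h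
      obtain ⟨Q, hQ, hp⟩ := h.1
      have hlow : ∀ b ∈ f '' A.disaggregable P, f p ≤ b := by
        rintro _ ⟨q, hq, rfl⟩
        exact ((hsolve s Q hQ).2 p hp).2 q ((hQ.invariant hcut).1 hq)
      exact ⟨s, hs, p, x, h, h1, h2, h3, ⟨f p, hlow⟩, le_csInf (hne.image f) hlow⟩
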